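/- Let $q=16$, $\ell=4$, $n=51$; the order of $16$ modulo $51$ is $2$. For $a\in\mathbb Z_{51}$ let $S_a=\{a\cdot 16^i \bmod 51 : i\ge 0\}$ be its $16$-cyclotomic coset, and let $\mathcal A$ be the set of all these cosets. Two cosets $A,B$ are dual if $a+c\equiv 0 \pmod{51}$ for some $a\in A$, $c\in B$; for $\mathcal S\subseteq\mathcal A$ let $\mathcal S^*$ be the set of duals of the members of $\mathcal S$ and let $4\mathcal S=\{S_{4a}: S_a\in\mathcal S\}$. For $\gamma\in\mathbb F_{16^{|S_a|}}$ put $f_{a,\gamma}(x)=\sum_{i=0}^{|S_a|-1}\gamma^{16^i}x^{(a16^i \bmod 51)}$, let $V_{\mathcal S}$ be the $\mathbb F_{16}$-span of all $f_{a,\gamma}$ with $S_a\in\mathcal S$, and let $C_{\mathcal S}=\{(f(\beta))_{\beta\in U_{51}\cup\{0\}} : f\in V_{\mathcal S}\}$, an $\mathbb F_{16}$-linear code of length $52$, where $U_{51}$ is the group of $51$st roots of unity in $\mathbb F_{256}$. Call $\mathcal S\subseteq\mathcal A$ admissible for $d$ if $\{0\}\in\mathcal S$, $\mathcal S\subseteq\mathcal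 T:=\{\{0\}\}\cup(\mathcal A\setminus(4\mathcal S)^*)$, and $S_a\in(4\mathcal S)^*$ for all integers $a$ with $53-d\le a\le 50$. A $4$-ary quantum code $[[N,k,d]]$ is a $4^k$-dimensional subspace of $(\mathbb C^4)^{\otimes N}$ with minimum distance at least $d$, that is, one that detects every error $E_1\otimes\cdots\otimes E_N$ in which fewer than $d$ of the factors differ from the identity. (i) For $\mathcal S=\{\{0\},\{12,39\},\{8,26\},\{4,13\}\}$ we have $4\mathcal S=\{\{0\},\{1,16\},\{2,32\},\{3,48\}\}$ and $(4\mathcal S)^*=\{\{0\},\{3,48\},\{19,49\},\{35,50\}\}$; this $\mathcal S$ is admissible for $d=5$, $52-2\dim_{\mathbb F_{16}} C_{\mathcal S}=38$, and there is a $4$-ary quantum code $[[52,38,5]]$. (ii) For each $(k,d)\in\{(34,6),(30,7),(26,8),(22,9),(18,10),(14,12)\}$ there is a set $\mathcal S$ of cosets that is admissible for $d$ with $52-2\dim_{\mathbb F_{16}}C_{\mathcal S}=k$, and there is a $4$-ary quantum code $[[52,k,d]]$. -/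

import Mathlib

/-! ### Cyclotomic cosets modulo `n` -/

/-- The `q`-cyclotomic coset `S_a = {a * q ^ i mod n : i = 0, 1, 2, ...}`. -/
def cyclotomicCoset (q n : ℕ) (a : ZMod n) : Set (ZMod n) :=
  {b | ∃ i : ℕ, b = a * (q : ZMod n) ^ i}

/-- The set of all `q`-cyclotomic cosets modulo `n`. -/
def allCosets (q n : ℕ) : Set (Set (ZMod n)) :=
  Set.range (cyclotomicCoset q n)

/-- Two cosets are dual if an element of the one and an element of the other add up to a
multiple of `n`. -/
def AreDualCosets {n : ℕ} (A B : Set (ZMod n)) : Prop :=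
  ∃ a ∈ A, ∃ c ∈ B, a + c = 0

/-- `𝒮^*`: the collection of the duals of the cosets in `𝒮`. -/
def dualFamily (q n : ℕ) (𝒮 : Set (Set (ZMod n))) : Set (Set (ZMod n)) :=
  {B | B ∈ allCosets q n ∧ ∃ A ∈ 𝒮, AreDualCosets A B}

/-- `ℓ𝒮`: the collection of the cosets `S_{a * ℓ}` for `S_a` in `𝒮`. -/
def scaledFamily (q n l : ℕ) (𝒮 : Set (Set (ZMod n))) : Set (Set (ZMod n)) :=
  {B | ∃ a : ZMod n, cyclotomicCoset q n a ∈ 𝒮 ∧ B = cyclotomicCoset q n (a * (l : ZMod n))}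

/-- `𝒯 = {{0}} ∪ (𝒜 - (ℓ𝒮)^*)`, where `𝒜` is the set of all cosets. -/
def hermitianDualFamily (q n l : ℕ) (𝒮 : Set (Set (ZMod n))) : Set (Set (ZMod n)) :=
  {{0}} ∪ (allCosets q n \ dualFamily q n (scaledFamily q n l 𝒮))

/-- The conditions on a set `𝒮` of cosets (containing the coset `{0}`) under which the polynomial
construction yields an `ℓ`-ary quantum code of length `n + 1` and distance at least `d`. -/
structure IsAdmissible (q n l d : ℕ) (𝒮 : Set (Set (ZMod n))) : Prop where
  isCoset : 𝒮 ⊆ allCosets q n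
  zero_mem : {0} ∈ 𝒮
  selfOrthogonal : 𝒮 ⊆ hermitianDualFamily q n l 𝒮
  distance : ∀ a : ℕ, n + 2 ≤ a + d → a + 1 ≤ n →
    cyclotomicCoset q n (a : ZMod n) ∈ dualFamily q n (scaledFamily q n l 𝒮)

/-! ### The classical polynomial codes -/

section ClassicalCode

variable (F K : Type*) [Field F] [Field K] [Algebra F K]

/-- The polynomial `∑_{i < s_a} (γ x ^ a) ^ (q ^ i)`, where `s_a = |S_a|` and exponents of `x` are
reduced to `0, ..., n - 1` modulo `n` (which changes no value at an `n`-th root of unity or `0`). -/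
noncomputable def cosetPolynomial (q n : ℕ) (a : ZMod n) (γ : K) : Polynomial K :=
  ∑ i ∈ Finset.range (cyclotomicCoset q n a).ncard,
    Polynomial.C (γ ^ q ^ i) * Polynomial.X ^ (a * (q : ZMod n) ^ i).val

/-- The `F`-space `V_𝒮` spanned by the polynomials of the cosets `S_a` in `𝒮`, where `F` is the
field of `q` elements. The coefficient `γ` runs over the whole subfield `{γ | γ ^ (q ^ s_a) = γ}`
of order `q ^ s_a`; as the polynomial is `F`-linear in `γ`, an `F`-basis of that subfield gives the
same span. -/
noncomputable def cosetPolynomialSpace (q n : ℕ) (𝒮 : Set (Set (ZMod n))) :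
    Submodule F (Polynomial K) :=
  Submodule.span F {f | ∃ (a : ZMod n) (γ : K), cyclotomicCoset q n a ∈ 𝒮 ∧
    γ ^ q ^ (cyclotomicCoset q n a).ncard = γ ∧ f = cosetPolynomial K q n a γ}

/-- The set `U_n ∪ {0}` of evaluation points. -/
abbrev EvalPoint (n : ℕ) : Type _ := {β : K // β ^ n = 1 ∨ β = 0}

/-- The `F`-linear code `C_𝒮 = {(f(β))_{β ∈ U_n ∪ {0}} : f ∈ V_𝒮}`, with entries in `F`. -/
noncomputable def cosetCode (q n : ℕ) (𝒮 : Set (Set (ZMod n))) :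
    Submodule F (EvalPoint K n → F) where
  carrier := {c | ∃ f ∈ cosetPolynomialSpace F K q n 𝒮,
    ∀ β : EvalPoint K n, algebraMap F K (c β) = f.eval (β : K)}
  zero_mem' := ⟨0, Submodule.zero_mem _, fun β => by simp⟩
  add_mem' := by
    rintro c c' ⟨f, hf, h⟩ ⟨f', hf', h'⟩
    exact ⟨f + f', Submodule.add_mem _ hf hf', fun β => by simp [h β, h' β]⟩
  smul_mem' := by
    rintro r c ⟨f, hf, h⟩
    refine ⟨r • f, Submodule.smul_mem _ r hf, fun β => ?_⟩
    rw [Polynomial.eval_smul, ← h β, Pi.smul_apply, smul_eq_mul, map_mul, Algebra.smul_def]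

end ClassicalCode

/-! ### Quantum codes -/

/-- The matrix of the error `E_1 ⊗ ... ⊗ E_n` on `n` qudits of dimension `l`, in the
computational basis, which is indexed by `Fin n → Fin l`. -/
noncomputable def tensorError {l n : ℕ} (E : Fin n → Matrix (Fin l) (Fin l) ℂ) :
    Matrix (Fin n → Fin l) (Fin n → Fin l) ℂ :=
  Matrix.of fun x y => ∏ i, E i (x i) (y i)

/-- The error `E` is detectable by the code `Q`: `P E P = c P` for some scalar `c`, where `P` is
the orthogonal projection onto `Q`; that is, `⟨u, E v⟩ = c ⟨u, v⟩` for all `u, v` in `Q`. -/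
def IsDetectable {l n : ℕ} (Q : Submodule ℂ ((Fin n → Fin l) → ℂ))
    (E : Matrix (Fin n → Fin l) (Fin n → Fin l) ℂ) : Prop :=
  ∃ c : ℂ, ∀ u ∈ Q, ∀ v ∈ Q, star u ⬝ᵥ E.mulVec v = c * (star u ⬝ᵥ v)

/-- `Q` is an `l`-ary quantum code `[[n, k, ≥ d]]`: a subspace of dimension `l ^ k` of
`(ℂ ^ l) ^ {⊗ n}` which detects all errors acting nontrivially on fewer than `d` qudits. -/
def IsQuantumCode (l n k d : ℕ) (Q : Submodule ℂ ((Fin n → Fin l) → ℂ)) : Prop :=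
  Module.finrank ℂ Q = l ^ k ∧
    ∀ E : Fin n → Matrix (Fin l) (Fin l) ℂ,
      {i | E i ≠ 1}.ncard < d → IsDetectable Q (tensorError E)

/-! All the codes come from one family: `𝒮` consists of the cosets of `0, 4, ..., 4m` with `3 ≤ m ≤
9`. Up to evaluation, `C_𝒮` is then the trace code of words `t + ∑ Tr (γ_j β ^ (4j))`, `1 ≤ j ≤ m`.
These cosets are distinct and, apart from `{0}`, have two elements, so the dimension is `1 + 2m` and
`k = 50 - 4m`.

Power sums over `U_51 ∪ {0}` vanish at every exponent prime to being a multiple of `51`, and also at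
exponent `0`, because `52` is even. Hermitian self-orthogonality therefore says that no nonconstant
product hits a multiple of `51`. Modulo `51` this reduces to `4i + j` and `i + 4j`, which lie
strictly between `0` and `51` for `i, j ≤ 9` not both `0`.

A relation among fewer than `d` coordinates gives weights whose power sums at the nodes `β ^ 4`
vanish in degrees `0, ..., d - 2`, so a Vandermonde argument kills it. Degrees up to `m` are
immediate. Degree `10` comes from degree `7` by Frobenius, since `7 * 16 ≡ 10` modulo `51`; this is
why `m = 9` reaches `d = 12`.

The passage to quantum codes is `exists_isQuantumCode_of_isotropic`: commuting Weyl operators have a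
joint eigenspace of the right dimension, and averaging an error over them turns it into a scalar
when the group is onto on the error's support. `exists_hyperbolic_coordinates` turns the Hermitian
form over 16 elements into the symplectic form over 4. Admissibility is a separate finite check. -/

open Matrix

/-! ### Tensor products of matrices. -/

section TensorError

variable {l n : ℕ}

theorem tensorError_apply (E : Fin n → Matrix (Fin l) (Fin l) ℂ) (x y : Fin n → Fin l) :
    tensorError E x y = ∏ i, E i (x i) (y i) := rfl

theorem tensorError_mul (E E' : Fin n → Matrix (Fin l) (Fin l) ℂ) :
    tensorError E * tensorError E' = tensorError fun i => E i * E' i := by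
  ext x y
  simp only [Matrix.mul_apply, tensorError_apply, ← Finset.prod_mul_distrib]
  rw [Finset.prod_univ_sum, Fintype.piFinset_univ]

theorem tensorError_one : tensorError (fun _ : Fin n => (1 : Matrix (Fin l) (Fin l) ℂ)) = 1 := by
  ext x y
  simp only [tensorError_apply, Matrix.one_apply, Finset.prod_ite_zero, Finset.mem_univ,
    true_implies, Finset.prod_const_one, funext_iff]

theorem conjTranspose_tensorError (E : Fin n → Matrix (Fin l) (Fin l) ℂ) :
    (tensorError E)ᴴ = tensorError fun i => (E i)ᴴ := by
  ext x y
  simp [tensorError_apply, Matrix.conjTranspose_apply]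

theorem trace_tensorError (E : Fin n → Matrix (Fin l) (Fin l) ℂ) :
    (tensorError E).trace = ∏ i, (E i).trace := by
  simp only [Matrix.trace, Matrix.diag_apply, tensorError_apply]
  rw [Finset.prod_univ_sum, Fintype.piFinset_univ]

theorem tensorError_smul (r : Fin n → ℂ) (E : Fin n → Matrix (Fin l) (Fin l) ℂ) :
    (tensorError fun i => r i • E i) = (∏ i, r i) • tensorError E := by
  ext x y
  simp [tensorError_apply, Finset.prod_mul_distrib]

end TensorError

/-! ### Weyl operators over a finite field. -/

section Weyl

variable {l n : ℕ} {L : Type*} [Field L] [DecidableEq L]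

/-- The Weyl operator `X(a) Z(b)` for `z = (a, b)`, on the space with basis indexed by `L`. -/
noncomputable def weylMatrix (e : Fin l ≃ L) (ψ : AddChar L ℂ) (z : L × L) :
    Matrix (Fin l) (Fin l) ℂ :=
  Matrix.of fun x y => if e x = e y + z.1 then ψ (z.2 * e y) else 0

variable (e : Fin l ≃ L) (ψ : AddChar L ℂ)

theorem mul_weylMatrix_apply (E : Matrix (Fin l) (Fin l) ℂ) (z : L × L) (x y : Fin l) :
    (E * weylMatrix e ψ z) x y = E x (e.symm (e y + z.1)) * ψ (z.2 * e y) := by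
  rw [Matrix.mul_apply, Finset.sum_eq_single (e.symm (e y + z.1))]
  · simp [weylMatrix]
  · intro b _ hb
    have : e b ≠ e y + z.1 := fun h => hb (by rw [← h, e.symm_apply_apply])
    simp [weylMatrix, this]
  · simp

theorem weylMatrix_zero : weylMatrix e ψ 0 = 1 := by
  ext x y
  simp [weylMatrix, Matrix.one_apply]

/-- The scalar is a cocycle: exchanging the factors changes it by the character of the symplectic
form, so isotropy means commutation. -/
theorem weylMatrix_mul (z z' : L × L) :
    weylMatrix e ψ z * weylMatrix e ψ z' = ψ (z.2 * z'.1) • weylMatrix e ψ (z + z') := by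
  ext x y
  rw [mul_weylMatrix_apply]
  simp only [weylMatrix, of_apply, Equiv.apply_symm_apply, Matrix.smul_apply, Prod.fst_add,
    Prod.snd_add, smul_eq_mul, ite_mul, zero_mul, mul_ite, mul_zero, add_assoc, add_comm z'.1]
  refine if_congr Iff.rfl ?_ rfl
  rw [← AddChar.map_add_eq_mul, ← AddChar.map_add_eq_mul]
  congr 1
  ring

/-- The tensor product of the Weyl operators of the coordinates of `z`. -/
noncomputable def weylTensor (e : Fin l ≃ L) (ψ : AddChar L ℂ) (z : Fin n → L × L) :
    Matrix (Fin n → Fin l) (Fin n → Fin l) ℂ :=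
  tensorError fun i => weylMatrix e ψ (z i)

theorem weylTensor_zero : weylTensor e ψ (0 : Fin n → L × L) = 1 := by
  simp [weylTensor, weylMatrix_zero, tensorError_one]

theorem AddChar.map_sum_eq_prod {ι A M : Type*} [AddCommMonoid A] [CommMonoid M] (ψ : AddChar A M)
    (s : Finset ι) (f : ι → A) : ψ (∑ i ∈ s, f i) = ∏ i ∈ s, ψ (f i) :=
  map_prod ψ.toMonoidHom (fun i => Multiplicative.ofAdd (f i)) s

theorem weylTensor_mul (z z' : Fin n → L × L) :
    weylTensor e ψ z * weylTensor e ψ z' =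
      ψ (∑ i, (z i).2 * (z' i).1) • weylTensor e ψ (z + z') := by
  rw [weylTensor, weylTensor, tensorError_mul]
  simp only [weylMatrix_mul]
  rw [tensorError_smul, AddChar.map_sum_eq_prod]
  rfl

variable [Fintype L]

theorem conjTranspose_weylMatrix_mul_apply (E : Matrix (Fin l) (Fin l) ℂ) (z : L × L)
    (x y : Fin l) :
    ((weylMatrix e ψ z)ᴴ * E) x y = ψ (-(z.2 * e x)) * E (e.symm (e x + z.1)) y := by
  rw [Matrix.mul_apply, Finset.sum_eq_single (e.symm (e x + z.1))]
  · simp [weylMatrix, AddChar.map_neg_eq_conj]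
  · intro b _ hb
    have : e b ≠ e x + z.1 := fun h => hb (by rw [← h, e.symm_apply_apply])
    simp [weylMatrix, this]
  · simp

theorem conjTranspose_weylMatrix_mul_self (z : L × L) :
    (weylMatrix e ψ z)ᴴ * weylMatrix e ψ z = 1 := by
  ext x y
  rw [conjTranspose_weylMatrix_mul_apply]
  by_cases h : x = y
  · subst h
    simp [weylMatrix, ← AddChar.map_add_eq_mul]
  · simp [weylMatrix, h]

variable {ψ}

theorem trace_weylMatrix (hψ : ψ.IsPrimitive) {z : L × L} (hz : z ≠ 0) :
    (weylMatrix e ψ z).trace = 0 := by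
  simp only [Matrix.trace, Matrix.diag_apply, weylMatrix, of_apply, left_eq_add]
  split_ifs with h
  · have hb : z.2 ≠ 0 := fun h' => hz (Prod.ext h h')
    rw [e.sum_comp fun x => ψ (z.2 * x)]
    simpa [mul_comm, hb] using AddChar.sum_mulShift z.2 hψ
  · simp

/-- Averaging a matrix over the Weyl operators produces a scalar matrix. -/
theorem sum_conjTranspose_weylMatrix_mul_mul (hψ : ψ.IsPrimitive)
    (E : Matrix (Fin l) (Fin l) ℂ) :
    ∑ z : L × L, (weylMatrix e ψ z)ᴴ * E * weylMatrix e ψ z = (l * E.trace) • 1 := by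
  ext x y
  have key (a b : L) : ((weylMatrix e ψ (a, b))ᴴ * E * weylMatrix e ψ (a, b)) x y =
      E (e.symm (a + e x)) (e.symm (a + e y)) * ψ (b * (e y - e x)) := by
    rw [mul_weylMatrix_apply, conjTranspose_weylMatrix_mul_apply, mul_right_comm,
      ← AddChar.map_add_eq_mul, mul_comm, add_comm a, add_comm a]
    congr 2
    ring
  have hl : Fintype.card L = l := by simpa using (Fintype.card_congr e).symm
  -- The sum over `b` is a character sum that forces `x = y`; the sum over the shift `a` then gives
  -- the trace.
  rw [Matrix.sum_apply, Fintype.sum_prod_type]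
  simp only [key, ← Finset.mul_sum, AddChar.sum_mulShift _ hψ, sub_eq_zero, e.injective.eq_iff,
    Matrix.smul_apply, Matrix.one_apply, smul_eq_mul, hl]
  rcases eq_or_ne x y with rfl | h
  · simp only [if_true, ← Finset.sum_mul, mul_one]
    have h := (Equiv.sum_comp (Equiv.addRight (e x)) fun a => E (e.symm a) (e.symm a)).trans
      (e.symm.sum_comp fun a => E a a)
    simp only [Equiv.coe_addRight] at h
    rw [h, mul_comm]
    rfl
  · simp [h, h.symm]

variable (ψ)

theorem conjTranspose_weylTensor_mul_self (z : Fin n → L × L) :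
    (weylTensor e ψ z)ᴴ * weylTensor e ψ z = 1 := by
  simp [weylTensor, conjTranspose_tensorError, tensorError_mul, conjTranspose_weylMatrix_mul_self,
    tensorError_one]

variable {ψ}

theorem trace_weylTensor (hψ : ψ.IsPrimitive) {z : Fin n → L × L} (hz : z ≠ 0) :
    (weylTensor e ψ z).trace = 0 := by
  obtain ⟨i, hi⟩ := Function.ne_iff.mp hz
  rw [weylTensor, trace_tensorError]
  exact Finset.prod_eq_zero (Finset.mem_univ i) (trace_weylMatrix e hψ hi)

end Weyl

/-- A finite commuting family of endomorphisms over an algebraically closed field has a common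
eigenvector. -/
theorem Module.End.exists_common_eigenvector {ι 𝕜 V : Type*} [Field 𝕜] [IsAlgClosed 𝕜]
    [AddCommGroup V] [Module 𝕜 V] [FiniteDimensional 𝕜 V] [Nontrivial V]
    (f : ι → Module.End 𝕜 V) (hf : ∀ i j, Commute (f i) (f j)) (s : Finset ι) :
    ∃ χ : ι → 𝕜, ∃ v ≠ 0, ∀ i ∈ s, f i v = χ i • v := by
  classical
  induction s using Finset.induction_on with
  | empty =>
    obtain ⟨v, hv⟩ := exists_ne (0 : V)
    exact ⟨0, v, hv, by simp⟩
  | insert j s hj ih =>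
    obtain ⟨χ, v, hv, h⟩ := ih
    let p : Submodule 𝕜 V := ⨅ i ∈ s, (f i).eigenspace (χ i)
    have hp (w : V) : w ∈ p ↔ ∀ i ∈ s, f i w = χ i • w := by
      simp [p, Submodule.mem_iInf]
    have hmaps : ∀ w ∈ p, f j w ∈ p := by
      intro w hw
      rw [hp] at hw ⊢
      intro i hi
      rw [← Module.End.mul_apply, (hf i j).eq, Module.End.mul_apply, hw i hi, map_smul]
    have : Nontrivial p := ⟨⟨⟨v, (hp v).2 h⟩, 0, fun h0 => hv (congrArg Subtype.val h0)⟩⟩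
    obtain ⟨μ, hμ⟩ := Module.End.exists_eigenvalue ((f j).restrict hmaps)
    obtain ⟨w, hw⟩ := hμ.exists_hasEigenvector
    refine ⟨Function.update χ j μ, w, fun h0 => hw.2 (Subtype.ext h0), fun i hi => ?_⟩
    rcases Finset.mem_insert.mp hi with rfl | hi
    · simpa using congrArg Subtype.val hw.apply_eq_smul
    · rw [Function.update_of_ne (ne_of_mem_of_not_mem hi hj)]
      exact (hp w).1 w.2 i hi

open scoped ComplexOrder

/-- A surjective homomorphism of finite groups has fibres of equal size. -/
theorem AddMonoidHom.sum_comp_of_surjective {G H M : Type*} [AddGroup G] [Fintype G] [AddGroup H]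
    [Fintype H] [AddCommMonoid M] (f : G →+ H) (hf : Function.Surjective f) (g : H → M) :
    ∑ x, g (f x) = Nat.card f.ker • ∑ y, g y := by
  classical
  rw [← Finset.sum_fiberwise_of_maps_to (fun x _ => Finset.mem_univ (f x)), Finset.smul_sum]
  refine Finset.sum_congr rfl fun y _ => ?_
  rw [Finset.sum_congr rfl fun x hx => by rw [(Finset.mem_filter.mp hx).2], Finset.sum_const]
  congr 1
  rw [AddMonoidHom.card_fiber_eq_of_mem_range f (hf y) ⟨0, map_zero f⟩, Nat.card_eq_fintype_card,
    Fintype.card_subtype]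
  simp [AddMonoidHom.mem_ker]

/-! ### Stabilizer codes of isotropic subgroups. -/

section StabilizerCode

variable {l n : ℕ} {L : Type*} [Field L] [Fintype L]

/-- Isotropy makes the Weyl operators of `D` commute, and `χ` records their eigenvalues on a common
eigenvector. Dividing by `χ` will undo the cocycle. -/
theorem exists_eigencharacter [DecidableEq L] (e : Fin l ≃ L) (ψ : AddChar L ℂ)
    (D : AddSubgroup (Fin n → L × L))
    (hD : ∀ z ∈ D, ∀ z' ∈ D, ∑ i, (z i).2 * (z' i).1 = ∑ i, (z' i).2 * (z i).1) :
    ∃ χ : D → ℂ, (∀ c, χ c ≠ 0) ∧ χ 0 = 1 ∧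
      ∀ c c' : D, χ c * χ c' = ψ (∑ i, (c.1 i).2 * (c'.1 i).1) * χ (c + c') := by
  have := Fintype.ofFinite D
  have : Nonempty (Fin l) := ⟨e.symm 0⟩
  have hcomm (c c' : D) : Commute (Matrix.toLin' (weylTensor e ψ c.1))
      (Matrix.toLin' (weylTensor e ψ c'.1)) := by
    rw [commute_iff_eq, Module.End.mul_eq_comp, Module.End.mul_eq_comp, ← Matrix.toLin'_mul,
      ← Matrix.toLin'_mul, weylTensor_mul, weylTensor_mul, hD _ c.2 _ c'.2, add_comm]
  obtain ⟨χ, v, hv, h⟩ := Module.End.exists_common_eigenvector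
    (fun c : D => Matrix.toLin' (weylTensor e ψ c.1)) hcomm Finset.univ
  replace h (c : D) : weylTensor e ψ c.1 *ᵥ v = χ c • v := h c (Finset.mem_univ c)
  refine ⟨χ, fun c h0 => hv ?_, smul_left_injective ℂ hv ?_, fun c c' =>
    smul_left_injective ℂ hv ?_⟩
  · rw [← one_mulVec v, ← conjTranspose_weylTensor_mul_self e ψ c.1, ← mulVec_mulVec, h, h0,
      zero_smul, mulVec_zero]
  · simp [← h, weylTensor_zero]
  · calc (χ c * χ c') • v = weylTensor e ψ c.1 *ᵥ weylTensor e ψ c'.1 *ᵥ v := by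
          rw [h, mulVec_smul, h, smul_smul, mul_comm]
      _ = _ := by
          rw [mulVec_mulVec, weylTensor_mul, smul_mulVec]
          exact (congrArg _ (h (c + c'))).trans (smul_smul _ _ _)

/-- Only the coordinates where `E` is not the identity matter. There `D` is onto with fibres of
equal size, so the sum is a multiple of the full Weyl average in each factor. -/
theorem sum_conjTranspose_weylTensor_mul_mul [DecidableEq L] (e : Fin l ≃ L) {ψ : AddChar L ℂ}
    (hψ : ψ.IsPrimitive) (D : AddSubgroup (Fin n → L × L))
    [Fintype D] (E : Fin n → Matrix (Fin l) (Fin l) ℂ)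
    (hsurj : ∀ w : Fin n → L × L, ∃ z ∈ D, ∀ i, E i ≠ 1 → z i = w i) :
    ∃ r : ℂ, ∑ c : D, (weylTensor e ψ c.1)ᴴ * tensorError E * weylTensor e ψ c.1 = r • 1 := by
  classical
  let f : D →+ ({i // E i ≠ 1} → L × L) :=
    { toFun := fun c i => c.1 i, map_zero' := rfl, map_add' := fun _ _ => rfl }
  have hf : Function.Surjective f := fun w => by
    obtain ⟨z, hz, h⟩ := hsurj fun i => if h : E i ≠ 1 then w ⟨i, h⟩ else 0
    exact ⟨⟨z, hz⟩, funext fun i => (h i i.2).trans (dif_pos i.2)⟩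
  let M (i : {i // E i ≠ 1}) (z : L × L) : Matrix (Fin l) (Fin l) ℂ :=
    (weylMatrix e ψ z)ᴴ * E i * weylMatrix e ψ z
  have hterm (c : D) (x y : Fin n → Fin l) :
      ((weylTensor e ψ c.1)ᴴ * tensorError E * weylTensor e ψ c.1) x y =
        (∏ i, M i (f c i) (x i) (y i)) *
          ∏ i : {i // ¬ E i ≠ 1}, (1 : Matrix (Fin l) (Fin l) ℂ) (x i) (y i) := by
    rw [weylTensor, conjTranspose_tensorError, tensorError_mul, tensorError_mul,
      tensorError_apply, ← Fintype.prod_subtype_mul_prod_subtype (fun i => E i ≠ 1)]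
    congr 1
    refine Finset.prod_congr rfl fun i _ => ?_
    rw [not_ne_iff.mp i.2, mul_one, conjTranspose_weylMatrix_mul_self]
  refine ⟨Nat.card f.ker * ∏ i : {i // E i ≠ 1}, (l * (E i).trace), ?_⟩
  ext x y
  have hprod : ∑ z : {i // E i ≠ 1} → L × L, ∏ i, M i (z i) (x i) (y i) =
      ∏ i, ∑ z, M i z (x i) (y i) := by
    rw [Finset.prod_univ_sum, Fintype.piFinset_univ]
  rw [Matrix.sum_apply, Finset.sum_congr rfl fun c _ => hterm c x y, ← Finset.sum_mul,
    f.sum_comp_of_surjective hf fun z => ∏ i, M i (z i) (x i) (y i), hprod]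
  have hM (i : {i // E i ≠ 1}) : ∑ z, M i z (x i) (y i) =
      (l * (E i).trace) * (1 : Matrix (Fin l) (Fin l) ℂ) (x i) (y i) := by
    rw [← Matrix.sum_apply, sum_conjTranspose_weylMatrix_mul_mul e hψ]
    rfl
  simp only [hM, Finset.prod_mul_distrib, nsmul_eq_mul, mul_assoc, Matrix.smul_apply, smul_eq_mul]
  rw [Fintype.prod_subtype_mul_prod_subtype (fun i => E i ≠ 1)
    fun i => (1 : Matrix (Fin l) (Fin l) ℂ) (x i) (y i), ← tensorError_apply, tensorError_one]

/-- The stabilizer code of an isotropic subgroup whose restriction to any fewer than `d`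
coordinates is onto. -/
theorem exists_isQuantumCode_of_isotropic {k d : ℕ} (e : Fin l ≃ L)
    (D : AddSubgroup (Fin n → L × L))
    (hD : ∀ z ∈ D, ∀ z' ∈ D, ∑ i, (z i).2 * (z' i).1 = ∑ i, (z' i).2 * (z i).1)
    (hcard : l ^ k * Nat.card D = l ^ n)
    (hsurj : ∀ J : Set (Fin n), J.ncard < d →
      ∀ w : Fin n → L × L, ∃ z ∈ D, ∀ i ∈ J, z i = w i) :
    ∃ Q, IsQuantumCode l n k d Q := by
  classical
  have := Fintype.ofFinite D
  have hψ := AddChar.FiniteField.primitiveChar_to_Complex_isPrimitive L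
  set ψ := AddChar.FiniteField.primitiveChar_to_Complex L
  obtain ⟨χ, hχ, hχ0, hmul⟩ := exists_eigencharacter e ψ D hD
  -- Rescaling by `χ` makes the projective action a genuine one; its invariants are the joint
  -- eigenspace.
  let ρ : Representation ℂ (Multiplicative D) ((Fin n → Fin l) → ℂ) :=
    { toFun := fun c => (χ c.toAdd)⁻¹ • Matrix.toLin' (weylTensor e ψ c.toAdd.1)
      map_one' := by simp [hχ0, weylTensor_zero]; rfl
      map_mul' := fun c c' => by
        rw [smul_mul_smul_comm, ← mul_inv, hmul, Module.End.mul_eq_comp,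
          ← Matrix.toLin'_mul, weylTensor_mul, map_smul,
          smul_smul, mul_inv, mul_right_comm, inv_mul_cancel₀, one_mul]
        · rfl
        · intro h0
          exact mul_ne_zero (hχ c.toAdd) (hχ c'.toAdd) (by rw [hmul, h0, zero_mul]) }
  have hinv (v : (Fin n → Fin l) → ℂ) (hv : v ∈ ρ.invariants) (c : D) :
      weylTensor e ψ c.1 *ᵥ v = χ c • v := by
    have h : (χ c)⁻¹ • weylTensor e ψ c.1 *ᵥ v = v := hv (Multiplicative.ofAdd c)
    rw [← (inv_smul_eq_iff₀ (hχ c)).mp h]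
  refine ⟨ρ.invariants, ?_, fun E hE => ?_⟩
  · have hpos : (Nat.card D : ℂ) ≠ 0 := by exact_mod_cast Nat.card_pos.ne'
    have : Invertible (Nat.card (Multiplicative D) : ℂ) := invertibleOfNonzero hpos
    -- Nontrivial Weyl operators are traceless, so averaging the character gives dimension `l ^ n /
    -- |D|`.
    have hρ (c : Multiplicative D) : LinearMap.trace ℂ _ (ρ c) =
        if c = 1 then (l : ℂ) ^ n else 0 := by
      have : LinearMap.trace ℂ _ (ρ c) =
          (χ c.toAdd)⁻¹ * (weylTensor e ψ c.toAdd.1).trace := by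
        simp [ρ]
      rw [this]
      split_ifs with h
      · subst h
        simp [hχ0, weylTensor_zero]
      · rw [trace_weylTensor e hψ, mul_zero]
        simpa using h
    have h2 : (Nat.card D : ℂ)⁻¹ * (l : ℂ) ^ n = Module.finrank ℂ ρ.invariants := by
      rw [← Representation.card_inv_mul_sum_char_eq_finrank]
      simp [Representation.character, hρ]
    rw [inv_mul_eq_iff_eq_mul₀ hpos] at h2
    have h3 : l ^ n = Nat.card D * Module.finrank ℂ ρ.invariants := by exact_mod_cast h2
    rw [← hcard, mul_comm] at h3
    exact (Nat.eq_of_mul_eq_mul_left Nat.card_pos h3).symm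
  · obtain ⟨r, hr⟩ := sum_conjTranspose_weylTensor_mul_mul e hψ D E
      fun w => hsurj _ hE w
    have hpos : (Fintype.card D : ℂ) ≠ 0 := by simp
    refine ⟨(Fintype.card D : ℂ)⁻¹ * r, fun u hu v hv => ?_⟩
    rcases eq_or_ne u 0 with rfl | hu0
    · simp
    have hinner (x y : (Fin n → Fin l) → ℂ) (c : D) :
        star (weylTensor e ψ c.1 *ᵥ x) ⬝ᵥ y = star x ⬝ᵥ (weylTensor e ψ c.1)ᴴ *ᵥ y := by
      rw [star_mulVec, dotProduct_mulVec]
    -- Eigenvalues of unitary operators have modulus one, so conjugating `E` by the stabilizer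
    -- leaves its matrix elements on the code unchanged.
    have hnorm (c : D) : star (χ c) * χ c = 1 := by
      have h := hinner u (weylTensor e ψ c.1 *ᵥ u) c
      rw [mulVec_mulVec, conjTranspose_weylTensor_mul_self, one_mulVec, hinv u hu, star_smul,
        smul_dotProduct, dotProduct_smul, smul_smul, smul_eq_mul] at h
      exact mul_right_cancel₀ (mt dotProduct_star_self_eq_zero.mp hu0) (by simpa using h)
    have hconj (c : D) : star u ⬝ᵥ
        ((weylTensor e ψ c.1)ᴴ * tensorError E * weylTensor e ψ c.1) *ᵥ v =
        star u ⬝ᵥ tensorError E *ᵥ v := by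
      rw [mul_assoc, ← mulVec_mulVec, ← hinner, ← mulVec_mulVec, hinv u hu, hinv v hv, mulVec_smul,
        star_smul, smul_dotProduct, dotProduct_smul, smul_smul, hnorm, one_smul]
    have hsum : (Fintype.card D : ℂ) * (star u ⬝ᵥ tensorError E *ᵥ v) = r * (star u ⬝ᵥ v) := by
      have h := Finset.sum_congr rfl fun c (_ : c ∈ Finset.univ) => hconj c
      rw [← dotProduct_sum, ← sum_mulVec, hr] at h
      simpa [smul_mulVec] using h.symm
    rw [mul_assoc, ← hsum, inv_mul_cancel_left₀ hpos]

end StabilizerCode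

/-! ### From Hermitian codes over 16 elements to stabilizer codes. -/

section HermitianCode

variable {F : Type*} [Field F]

theorem two_eq_zero_of_card_eq (hF : Nat.card F = 16) : (2 : F) = 0 := by
  have : Finite F := Nat.finite_of_card_ne_zero (by simp [hF])
  have := Fintype.ofFinite F
  have h : ((16 : ℕ) : F) = 0 := by
    rw [← hF, Nat.card_eq_fintype_card, Nat.cast_card_eq_zero]
  have h' : (2 : F) ^ 4 = 0 := by norm_num at h ⊢; exact h
  exact pow_eq_zero_iff (by norm_num) |>.mp h'

theorem pow_sixteen_of_card_eq (hF : Nat.card F = 16) (c : F) : c ^ 16 = c := by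
  have : Finite F := Nat.finite_of_card_ne_zero (by simp [hF])
  have := Fintype.ofFinite F
  simpa [← hF, Nat.card_eq_fintype_card] using FiniteField.pow_card c

/-- In the field of `16` elements, some `ω` has trace `1` over the field of `4` elements. -/
theorem exists_add_pow_four_eq_one (hF : Nat.card F = 16) : ∃ ω : F, ω + ω ^ 4 = 1 := by
  have h2 := two_eq_zero_of_card_eq hF
  have h16 := pow_sixteen_of_card_eq hF
  have : CharP F 2 := CharTwo.of_one_ne_zero_of_two_eq_zero one_ne_zero h2
  have hF' : Finite F := Nat.finite_of_card_ne_zero (by simp [hF])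
  have := Fintype.ofFinite F
  -- A polynomial of degree `4` cannot vanish at all `16` elements. Its value at `x` is fixed by the
  -- fourth power, so dividing `x` by it normalizes the trace to `1`.
  obtain ⟨x, hx⟩ : ∃ x : F, x + x ^ 4 ≠ 0 := by
    by_contra! h
    have hp : (Polynomial.X + Polynomial.X ^ 4 : Polynomial F).natDegree = 4 := by compute_degree!
    have h0 : (Polynomial.X + Polynomial.X ^ 4 : Polynomial F) ≠ 0 := by
      intro h0
      simp [h0] at hp
    have := Polynomial.card_le_degree_of_subset_roots (p := (Polynomial.X + Polynomial.X ^ 4 :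
      Polynomial F)) (Z := Finset.univ) (fun x _ => by
        simpa [Polynomial.mem_roots h0] using h x)
    rw [hp, Finset.card_univ, ← Nat.card_eq_fintype_card, hF] at this
    omega
  refine ⟨x / (x + x ^ 4), ?_⟩
  have ht : (x + x ^ 4) ^ 4 = x + x ^ 4 := by
    have h := add_pow_char_pow (p := 2) (n := 2) (x := x) (y := x ^ 4)
    norm_num [← pow_mul] at h
    rw [h, h16, add_comm]
  rw [div_pow, ht, ← add_div, div_self hx]

/-- The field of `16` elements is the hyperbolic plane over its subfield of `4` elements for the
alternating form attached to the Hermitian form. -/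
theorem exists_hyperbolic_coordinates (hF : Nat.card F = 16) :
    ∃ (L : Subfield F) (θ : F ≃+ L × L), ∀ c c' : F,
      (((θ c).1 * (θ c').2 + (θ c).2 * (θ c').1 : L) : F) = c * c' ^ 4 + c ^ 4 * c' := by
  have h2 := two_eq_zero_of_card_eq hF
  have h16 := pow_sixteen_of_card_eq hF
  have : CharP F 2 := CharTwo.of_one_ne_zero_of_two_eq_zero one_ne_zero h2
  obtain ⟨ω, hω⟩ := exists_add_pow_four_eq_one hF
  have hadd (x y : F) : (x + y) ^ 4 = x ^ 4 + y ^ 4 := by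
    simpa using add_pow_char_pow (p := 2) (n := 2) (x := x) (y := y)
  let L : Subfield F := RingHom.eqLocusField (iterateFrobenius F 2 2) (RingHom.id F)
  have hL (x : F) : x ∈ L ↔ x ^ 4 = x := by
    change iterateFrobenius F 2 2 x = x ↔ _
    rw [iterateFrobenius_def]
    norm_num
  have hβ (c : F) : c + c ^ 4 ∈ L := by
    rw [hL, hadd, ← pow_mul, h16, add_comm]
  have hα (c : F) : c + ω * (c + c ^ 4) ∈ L := by
    rw [hL, hadd, mul_pow, hadd, ← pow_mul, h16]
    linear_combination (c + c ^ 4) * hω + (c + c ^ 4 - (c + ω * (c + c ^ 4))) * h2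
  -- In the basis `1, ω` over the fixed field of `x ↦ x ^ 4`, the `ω`-coordinate of `c` is its trace
  -- `c + c ^ 4`, because `ω` has trace `1` and elements of `L` have trace `0`.
  let θ : F ≃+ L × L :=
    { toFun := fun c => (⟨_, hα c⟩, ⟨_, hβ c⟩)
      invFun := fun z => z.1 + ω * z.2
      left_inv := fun c => by
        change c + ω * (c + c ^ 4) + ω * (c + c ^ 4) = c
        linear_combination ω * (c + c ^ 4) * h2
      right_inv := fun ⟨⟨a, ha⟩, ⟨b, hb⟩⟩ => by
        rw [hL] at ha hb
        have h : a + ω * b + (a + ω * b) ^ 4 = b := by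
          rw [hadd, mul_pow, ha, hb]
          linear_combination a * h2 + b * hω
        refine Prod.ext (Subtype.ext ?_) (Subtype.ext h)
        change a + ω * b + ω * (a + ω * b + (a + ω * b) ^ 4) = a
        rw [h]
        linear_combination ω * b * h2
      map_add' := fun c c' => by
        refine Prod.ext (Subtype.ext ?_) (Subtype.ext ?_)
        · change c + c' + ω * (c + c' + (c + c') ^ 4) =
            c + ω * (c + c ^ 4) + (c' + ω * (c' + c' ^ 4))
          rw [hadd]
          ring
        · change c + c' + (c + c') ^ 4 = c + c ^ 4 + (c' + c' ^ 4)
          rw [hadd]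
          ring }
  refine ⟨L, θ, fun c c' => ?_⟩
  change (c + ω * (c + c ^ 4)) * (c' + c' ^ 4) + (c + c ^ 4) * (c' + ω * (c' + c' ^ 4)) = _
  linear_combination (c * c' + ω * (c + c ^ 4) * (c' + c' ^ 4)) * h2

/-- The quantum code of a Hermitian self-orthogonal linear code over the field of `16` elements
that takes all values on any fewer than `d` coordinates. -/
theorem exists_isQuantumCode_of_hermitian (hF : Nat.card F = 16) {n k d : ℕ}
    (C : Submodule F (Fin n → F)) (hself : ∀ c ∈ C, ∀ c' ∈ C, ∑ i, c i * c' i ^ 4 = 0)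
    (hk : k + 2 * Module.finrank F C = n)
    (hsurj : ∀ J : Set (Fin n), J.ncard < d → ∀ w : Fin n → F, ∃ c ∈ C, ∀ i ∈ J, c i = w i) :
    ∃ Q, IsQuantumCode 4 n k d Q := by
  obtain ⟨L, θ, hθ⟩ := exists_hyperbolic_coordinates hF
  have : Finite F := Nat.finite_of_card_ne_zero (by simp [hF])
  have := Fintype.ofFinite F
  have := Fintype.ofFinite L
  have hL : Nat.card L = 4 := by
    have h := Nat.card_congr θ.toEquiv
    rw [Nat.card_prod, hF] at h
    nlinarith
  let Θ : (Fin n → F) →+ (Fin n → L × L) :=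
    { toFun := fun c i => θ (c i)
      map_zero' := funext fun _ => map_zero θ
      map_add' := fun c c' => funext fun i => map_add θ (c i) (c' i) }
  have hΘ : Function.Injective Θ := fun c c' h => funext fun i => θ.injective (congrFun h i)
  have h2 := two_eq_zero_of_card_eq hF
  refine exists_isQuantumCode_of_isotropic (L := L)
    (Fintype.equivFinOfCardEq (by rw [← Nat.card_eq_fintype_card, hL])).symm
    (C.toAddSubgroup.map Θ) ?_ ?_ ?_
  · rintro _ ⟨c, hc, rfl⟩ _ ⟨c', hc', rfl⟩
    refine Subtype.ext ?_
    have h : ∑ i, (((θ (c i)).1 * (θ (c' i)).2 + (θ (c i)).2 * (θ (c' i)).1 : L) : F) = 0 := by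
      simp only [hθ, Finset.sum_add_distrib, hself c hc c' hc', zero_add]
      rw [← hself c' hc' c hc]
      exact Finset.sum_congr rfl fun i _ => mul_comm _ _
    simp only [Subfield.coe_add, Finset.sum_add_distrib] at h
    have h' (x y : F) (hxy : x + y = 0) : y = x := by linear_combination hxy - x * h2
    push_cast at h ⊢
    refine (h' _ _ h).trans (Finset.sum_congr rfl fun i _ => mul_comm _ _)
  · have h : Nat.card (C.toAddSubgroup.map Θ) = Nat.card C :=
      (Nat.card_congr (C.toAddSubgroup.equivMapOfInjective Θ hΘ).toEquiv).symm
    have hn : 4 ^ n = 4 ^ k * 16 ^ Module.finrank F C := by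
      conv_lhs => rw [← hk, pow_add, pow_mul]
      norm_num
    rw [h, Module.natCard_eq_pow_finrank (K := F), hF, hn]
  · intro J hJ w
    obtain ⟨c, hc, h⟩ := hsurj J hJ fun i => θ.symm (w i)
    exact ⟨Θ c, ⟨c, hc, rfl⟩, fun i hi => by simp [Θ, h i hi]⟩

end HermitianCode

/-! ### Cosets modulo 51 and admissibility. -/

section Cosets

theorem cyclotomicCoset_eq_pair (a : ZMod 51) : cyclotomicCoset 16 51 a = {a, a * 16} := by
  ext b
  simp only [cyclotomicCoset, Set.mem_ofPred_eq, Set.mem_insert_iff, Set.mem_singleton_iff]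
  constructor
  · rintro ⟨i, rfl⟩
    have h : ((16 : ℕ) : ZMod 51) ^ 2 = 1 := by decide
    rcases i.even_or_odd' with ⟨j, rfl | rfl⟩
    · left
      rw [pow_mul, h, one_pow, mul_one]
    · right
      rw [pow_succ, pow_mul, h, one_pow, one_mul]
      rfl
  · rintro (rfl | rfl)
    · exact ⟨0, by simp⟩
    · exact ⟨1, by simp⟩

theorem mul_sixteen_mul_sixteen (a : ZMod 51) : a * 16 * 16 = a := by
  rw [mul_assoc, show (16 * 16 : ZMod 51) = 1 by decide, mul_one]

theorem cyclotomicCoset_eq_iff (a b : ZMod 51) :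
    cyclotomicCoset 16 51 a = cyclotomicCoset 16 51 b ↔ a = b ∨ a = b * 16 := by
  constructor
  · intro h
    have ha : a ∈ cyclotomicCoset 16 51 b := h ▸ by simp [cyclotomicCoset_eq_pair]
    simpa [cyclotomicCoset_eq_pair] using ha
  · rintro (rfl | rfl)
    · rfl
    · rw [cyclotomicCoset_eq_pair, cyclotomicCoset_eq_pair, mul_sixteen_mul_sixteen, Set.pair_comm]

theorem cyclotomicCoset_eq_of_mem {a b : ZMod 51} (h : a ∈ cyclotomicCoset 16 51 b) :
    cyclotomicCoset 16 51 a = cyclotomicCoset 16 51 b := by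
  rw [cyclotomicCoset_eq_iff]
  simpa [cyclotomicCoset_eq_pair] using h

theorem mem_cyclotomicCoset_self (a : ZMod 51) : a ∈ cyclotomicCoset 16 51 a := by
  simp [cyclotomicCoset_eq_pair]

theorem cyclotomicCoset_zero : cyclotomicCoset 16 51 0 = {0} := by
  simp [cyclotomicCoset_eq_pair]

/-- The set of the cosets of the elements of `A`. -/
def cosetFamily (A : Finset (ZMod 51)) : Set (Set (ZMod 51)) :=
  cyclotomicCoset 16 51 '' A

theorem cyclotomicCoset_mem_cosetFamily {A : Finset (ZMod 51)} {a : ZMod 51} :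
    cyclotomicCoset 16 51 a ∈ cosetFamily A ↔ ∃ b ∈ A, a = b ∨ a = b * 16 := by
  simp only [cosetFamily, Set.mem_image, Finset.mem_coe, ← cyclotomicCoset_eq_iff, eq_comm]

theorem scaledFamily_cosetFamily (A : Finset (ZMod 51)) :
    scaledFamily 16 51 4 (cosetFamily A) = cosetFamily (A.image (· * 4)) := by
  ext B
  constructor
  · rintro ⟨a, ha, rfl⟩
    rw [cyclotomicCoset_mem_cosetFamily] at ha ⊢
    obtain ⟨b, hb, h⟩ := ha
    refine ⟨b * 4, Finset.mem_image_of_mem _ hb, ?_⟩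
    rcases h with rfl | rfl
    · exact Or.inl rfl
    · exact Or.inr (mul_right_comm _ _ _)
  · rintro ⟨_, h, rfl⟩
    obtain ⟨a, ha, rfl⟩ := Finset.mem_image.mp h
    exact ⟨a, Set.mem_image_of_mem _ ha, rfl⟩

theorem dualFamily_cosetFamily (A : Finset (ZMod 51)) :
    dualFamily 16 51 (cosetFamily A) = cosetFamily (A.image (- ·)) := by
  ext B
  constructor
  · rintro ⟨⟨b, rfl⟩, _, ⟨a, ha, rfl⟩, x, hx, c, hc, h⟩
    rw [← cyclotomicCoset_eq_of_mem hc, cyclotomicCoset_mem_cosetFamily]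
    refine ⟨-a, Finset.mem_image_of_mem _ ha, ?_⟩
    rw [eq_neg_of_add_eq_zero_right h, ← neg_mul_eq_neg_mul, neg_inj, neg_inj]
    simpa [cyclotomicCoset_eq_pair] using hx
  · rintro ⟨_, h, rfl⟩
    obtain ⟨a, ha, rfl⟩ := Finset.mem_image.mp h
    exact ⟨⟨_, rfl⟩, _, Set.mem_image_of_mem _ ha, a, mem_cyclotomicCoset_self a, -a,
      mem_cyclotomicCoset_self _, add_neg_cancel a⟩

/-- The residues `0, 4, 8, ..., 4 m`. -/
def cosetReps (m : ℕ) : Finset (ZMod 51) :=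
  (Finset.range (m + 1)).image fun j => ((4 * j : ℕ) : ZMod 51)

/-- The dual of the scaled coset of `4j` is the coset of `-j`, so the distance condition asks that
`1, ..., d - 2` lie in cosets of `0, ..., m`. -/
theorem isAdmissible_cosetFamily {m d : ℕ} (hm : m ≤ 9)
    (h : ∀ a < 51, 53 ≤ a + d → ∃ j ≤ m, (a : ZMod 51) = -((4 * j : ℕ) * 4) ∨
      (a : ZMod 51) = -((4 * j : ℕ) * 4) * 16) :
    IsAdmissible 16 51 4 d (cosetFamily (cosetReps m)) where
  isCoset := by
    rintro _ ⟨a, -, rfl⟩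
    exact ⟨a, rfl⟩
  zero_mem := ⟨0, by simp [cosetReps]; exact ⟨0, by omega, by simp⟩, cyclotomicCoset_zero⟩
  selfOrthogonal := by
    -- The case `i = 0` is exempt because `{0}` is its own dual. Otherwise a coincidence would make
    -- `i + 4j` or `4i + j` a multiple of `51`.
    have hdisj : ∀ i < 10, ∀ j < 10, i = 0 ∨
        ¬ (((4 * i : ℕ) : ZMod 51) = -((4 * j : ℕ) * 4) ∨
          ((4 * i : ℕ) : ZMod 51) = -((4 * j : ℕ) * 4) * 16) := by decide
    rintro _ ⟨_, hi, rfl⟩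
    obtain ⟨i, hi', rfl⟩ := Finset.mem_image.mp hi
    rw [Finset.mem_range] at hi'
    rcases eq_or_ne i 0 with rfl | hi0
    · left
      simp [cyclotomicCoset_zero]
    · refine Or.inr ⟨⟨_, rfl⟩, fun h => ?_⟩
      rw [scaledFamily_cosetFamily, dualFamily_cosetFamily, cyclotomicCoset_mem_cosetFamily] at h
      obtain ⟨_, hb, h⟩ := h
      simp only [cosetReps, Finset.mem_image, Finset.mem_range, exists_exists_and_eq_and] at hb
      obtain ⟨j, hj, rfl⟩ := hb
      exact ((hdisj i (by omega) j (by omega)).resolve_left hi0) h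
  distance := fun a ha ha' => by
    rw [scaledFamily_cosetFamily, dualFamily_cosetFamily, cyclotomicCoset_mem_cosetFamily]
    obtain ⟨j, hj, h⟩ := h a (by omega) (by omega)
    refine ⟨_, Finset.mem_image_of_mem _ (Finset.mem_image_of_mem _
      (Finset.mem_image_of_mem _ (Finset.mem_range.mpr (Nat.lt_succ_of_le hj)))), h⟩

theorem cosetFamily_cosetReps_three :
    cosetFamily (cosetReps 3) = {{0}, {12, 39}, {8, 26}, {4, 13}} := by
  rw [cosetFamily, show cosetReps 3 = {0, 12, 8, 4} by decide]
  simp only [Finset.coe_insert, Finset.coe_singleton, Set.image_insert_eq, Set.image_singleton,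
    cyclotomicCoset_zero]
  simp only [cyclotomicCoset_eq_pair]
  rfl

theorem scaledFamily_cosetReps_three :
    scaledFamily 16 51 4 (cosetFamily (cosetReps 3)) = {{0}, {1, 16}, {2, 32}, {3, 48}} := by
  rw [scaledFamily_cosetFamily, cosetFamily,
    show (cosetReps 3).image (· * 4) = {0, 16, 32, 48} by decide]
  simp only [Finset.coe_insert, Finset.coe_singleton, Set.image_insert_eq, Set.image_singleton,
    cyclotomicCoset_zero]
  simp only [cyclotomicCoset_eq_pair, Set.pair_comm _ ((_ : ZMod 51) * 16)]
  rfl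

theorem dualFamily_cosetReps_three :
    dualFamily 16 51 (scaledFamily 16 51 4 (cosetFamily (cosetReps 3))) =
      {{0}, {3, 48}, {19, 49}, {35, 50}} := by
  rw [scaledFamily_cosetFamily, dualFamily_cosetFamily, cosetFamily,
    show ((cosetReps 3).image (· * 4)).image (- ·) = {0, 3, 19, 35} by decide]
  simp only [Finset.coe_insert, Finset.coe_singleton, Set.image_insert_eq, Set.image_singleton,
    cyclotomicCoset_zero]
  simp only [cyclotomicCoset_eq_pair]
  rfl

theorem orderOf_sixteen : orderOf (16 : ZMod 51) = 2 :=
  orderOf_eq_prime (by decide) (by decide)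

end Cosets

/-! ### Traces and power sums over the evaluation points. -/

section EvaluationPoints

variable {F K : Type*} [Field F] [Field K] [Algebra F K]

theorem finrank_eq_two_of_card_eq (hF : Nat.card F = 16) (hK : Nat.card K = 16 ^ 2) :
    Module.finrank F K = 2 := by
  have : Finite K := Nat.finite_of_card_ne_zero (by simp [hK])
  have h := Module.natCard_eq_pow_finrank (K := F) (V := K)
  rw [hF, hK] at h
  exact (Nat.pow_right_injective (by norm_num : 2 ≤ 16) h).symm

theorem pow_of_card_eq (hK : Nat.card K = 16 ^ 2) (x : K) : (x ^ 16) ^ 16 = x := by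
  have : Finite K := Nat.finite_of_card_ne_zero (by simp [hK])
  have := Fintype.ofFinite K
  rw [← pow_mul]
  simpa [← Nat.card_eq_fintype_card, hK] using FiniteField.pow_card x

theorem algebraMap_trace_of_card_eq (hF : Nat.card F = 16) (hK : Nat.card K = 16 ^ 2) (x : K) :
    algebraMap F K (Algebra.trace F K x) = x + x ^ 16 := by
  have : Finite K := Nat.finite_of_card_ne_zero (by simp [hK])
  rw [FiniteField.algebraMap_trace_eq_sum_pow, finrank_eq_two_of_card_eq hF hK, hF]
  simp [Finset.sum_range_succ]

/-- For `y` of trace `1`, the trace of `x * y` is `x`, since `x` is fixed by Frobenius. -/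
theorem mem_range_algebraMap_of_pow_eq (hF : Nat.card F = 16) (hK : Nat.card K = 16 ^ 2) {x : K}
    (hx : x ^ 16 = x) : ∃ t : F, algebraMap F K t = x := by
  have : Finite K := Nat.finite_of_card_ne_zero (by simp [hK])
  have : Finite F := Nat.finite_of_card_ne_zero (by simp [hF])
  obtain ⟨y, hy⟩ := Algebra.trace_surjective F K 1
  refine ⟨Algebra.trace F K (x * y), ?_⟩
  rw [algebraMap_trace_of_card_eq hF hK, mul_pow, hx, ← mul_add,
    ← algebraMap_trace_of_card_eq hF hK, hy, map_one, mul_one]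

/-- Exponent `0` is excluded because of the point `0`, where `0 ^ 0 = 1` but `0 ^ 51 = 0`. -/
theorem EvalPoint.pow_add_period (β : EvalPoint K 51) {a : ℕ} (ha : a ≠ 0) (k : ℕ) :
    (β : K) ^ (a + 51 * k) = (β : K) ^ a := by
  rcases β.2 with h | h
  · rw [pow_add, pow_mul, h, one_pow, mul_one]
  · rw [h, zero_pow ha, zero_pow (by omega)]

theorem EvalPoint.pow_val (β : EvalPoint K 51) {a : ℕ} (ha : ¬ 51 ∣ a) :
    (β : K) ^ (a : ZMod 51).val = (β : K) ^ a := by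
  rw [ZMod.val_natCast]
  conv_rhs => rw [← Nat.mod_add_div a 51]
  rw [β.pow_add_period (by omega)]

theorem exists_isPrimitiveRoot_of_card_eq (hK : Nat.card K = 16 ^ 2) :
    ∃ ζ : K, IsPrimitiveRoot ζ 51 := by
  have : Finite K := Nat.finite_of_card_ne_zero (by simp [hK])
  obtain ⟨g, hg⟩ := IsCyclic.exists_ofOrder_eq_natCard (α := Kˣ)
  have h255 : Nat.card Kˣ = 255 := by
    rw [Nat.card_units, hK]
    norm_num
  rw [h255] at hg
  have h := (IsPrimitiveRoot.orderOf g).pow (by rw [hg]; norm_num)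
    (show orderOf g = 5 * 51 by rw [hg])
  exact ⟨_, h.map_of_injective Units.coeHom_injective⟩

theorem card_evalPoint (hK : Nat.card K = 16 ^ 2) : Nat.card (EvalPoint K 51) = 52 := by
  classical
  obtain ⟨ζ, hζ⟩ := exists_isPrimitiveRoot_of_card_eq hK
  have h (x : K) : x ∈ insert 0 (Polynomial.nthRootsFinset 51 (1 : K)) ↔ x ^ 51 = 1 ∨ x = 0 := by
    rw [Finset.mem_insert, Polynomial.mem_nthRootsFinset (by norm_num), or_comm]
  rw [Nat.subtype_card _ h, Finset.card_insert_of_notMem, hζ.card_nthRootsFinset]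
  rw [Polynomial.mem_nthRootsFinset (by norm_num)]
  norm_num

variable [Fintype (EvalPoint K 51)]

theorem sum_evalPoint_pow_zero (hK : Nat.card K = 16 ^ 2) (h2 : (2 : K) = 0) :
    ∑ β : EvalPoint K 51, (β : K) ^ 0 = 0 := by
  have h : Fintype.card (EvalPoint K 51) = 52 := by
    rw [← Nat.card_eq_fintype_card, card_evalPoint hK]
  simp only [pow_zero, Finset.sum_const, Finset.card_univ, h, nsmul_eq_mul, mul_one]
  push_cast
  linear_combination 26 * h2

/-- Multiplication by a primitive root `ζ` permutes the points and scales the sum by `ζ ^ b ≠ 1`. -/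
theorem sum_evalPoint_pow (hK : Nat.card K = 16 ^ 2) {b : ℕ} (hb : ¬ 51 ∣ b) :
    ∑ β : EvalPoint K 51, (β : K) ^ b = 0 := by
  obtain ⟨ζ, hζ⟩ := exists_isPrimitiveRoot_of_card_eq hK
  have h0 : ζ ≠ 0 := hζ.ne_zero (by norm_num)
  let σ : EvalPoint K 51 ≃ EvalPoint K 51 := (Equiv.mulLeft₀ ζ h0).subtypeEquiv fun x => by
    simp [mul_pow, hζ.pow_eq_one, h0]
  have h : ζ ^ b * ∑ β : EvalPoint K 51, (β : K) ^ b = ∑ β : EvalPoint K 51, (β : K) ^ b := by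
    rw [Finset.mul_sum]
    refine (Finset.sum_congr rfl fun β _ => ?_).trans (σ.sum_comp fun β => (β : K) ^ b)
    rw [← mul_pow]
    rfl
  have hζb : ζ ^ b - 1 ≠ 0 := sub_ne_zero.mpr fun h => hb (hζ.dvd_of_pow_eq_one b h)
  refine (mul_eq_zero.mp ?_).resolve_left hζb
  rw [sub_mul, h, one_mul, sub_self]

theorem sum_evalPoint_pow_period (hK : Nat.card K = 16 ^ 2) (h2 : (2 : K) = 0) :
    ∑ β : EvalPoint K 51, (β : K) ^ 51 = 1 := by
  classical
  have h : ∑ β : EvalPoint K 51, ((β : K) ^ 0 - (β : K) ^ 51) = 1 := by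
    rw [Finset.sum_eq_single ⟨0, Or.inr rfl⟩]
    · simp
    · intro β _ hβ
      rcases β.2 with h | h
      · simp [h]
      · exact absurd (Subtype.ext h) hβ
    · simp
  rw [Finset.sum_sub_distrib, sum_evalPoint_pow_zero hK h2] at h
  linear_combination -h - h2

end EvaluationPoints

/-! ### The polynomial code as a trace code. -/

section TraceCode

variable (F K : Type*) [Field F] [Field K] [Algebra F K]

/-- The encoder `(t, γ) ↦ (t + ∑ j, Tr (γ_j β ^ (4 (j + 1))))_β`. -/
noncomputable def traceEncoder (m : ℕ) : (F × (Fin m → K)) →ₗ[F] (EvalPoint K 51 → F) where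
  toFun p β := p.1 + ∑ j, Algebra.trace F K (p.2 j * (β : K) ^ (4 * (j.1 + 1)))
  map_add' p p' := by
    ext β
    simp only [Prod.fst_add, Prod.snd_add, Pi.add_apply, add_mul, map_add, Finset.sum_add_distrib]
    ring
  map_smul' r p := by
    ext β
    simp [Finset.mul_sum, mul_add]

variable {F K}

theorem traceEncoder_apply {m : ℕ} (p : F × (Fin m → K)) (β : EvalPoint K 51) :
    traceEncoder F K m p β =
      p.1 + ∑ j, Algebra.trace F K (p.2 j * (β : K) ^ (4 * (j.1 + 1))) := rfl

theorem algebraMap_traceEncoder (hF : Nat.card F = 16) (hK : Nat.card K = 16 ^ 2) {m : ℕ}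
    (p : F × (Fin m → K)) (β : EvalPoint K 51) :
    algebraMap F K (traceEncoder F K m p β) = algebraMap F K p.1 +
      ∑ j, (p.2 j * (β : K) ^ (4 * (j.1 + 1)) + p.2 j ^ 16 * (β : K) ^ (64 * (j.1 + 1))) := by
  rw [traceEncoder_apply, map_add, map_sum]
  congr 1
  refine Finset.sum_congr rfl fun j _ => ?_
  rw [algebraMap_trace_of_card_eq hF hK, mul_pow, ← pow_mul]
  congr 3
  ring

theorem eval_cosetPolynomial_zero (γ : K) (β : K) :
    (cosetPolynomial K 16 51 0 γ).eval β = γ := by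
  simp [cosetPolynomial, cyclotomicCoset_zero]

theorem mul_sixteen_ne_self {j : ℕ} (hj : j < 9) :
    ((4 * (j + 1) : ℕ) : ZMod 51) ≠ ((4 * (j + 1) : ℕ) : ZMod 51) * 16 := by
  revert j
  decide

theorem eval_cosetPolynomial {a : ℕ} (ha : ((a : ℕ) : ZMod 51) ≠ (a : ZMod 51) * 16) (γ : K)
    (β : EvalPoint K 51) :
    (cosetPolynomial K 16 51 a γ).eval (β : K) = γ * (β : K) ^ a + γ ^ 16 * (β : K) ^ (16 * a) := by
  have h0 : ¬ 51 ∣ a := fun h => ha (by simp [(ZMod.natCast_eq_zero_iff a 51).mpr h])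
  have h : (a : ZMod 51) * 16 = ((16 * a : ℕ) : ZMod 51) := by push_cast; ring
  rw [cosetPolynomial, cyclotomicCoset_eq_pair, Set.ncard_pair ha]
  simp only [Finset.sum_range_succ, Finset.sum_range_zero, zero_add, pow_zero, pow_one, mul_one,
    Polynomial.eval_add, Polynomial.eval_mul, Polynomial.eval_C, Polynomial.eval_pow,
    Polynomial.eval_X, Nat.cast_ofNat]
  rw [h, β.pow_val h0, β.pow_val (by omega)]

theorem cosetCode_eq_range (hF : Nat.card F = 16) (hK : Nat.card K = 16 ^ 2) {m : ℕ}
    (hm : m ≤ 9) :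
    cosetCode F K 16 51 (cosetFamily (cosetReps m)) = LinearMap.range (traceEncoder F K m) := by
  apply le_antisymm
  · rintro c ⟨f, hf, hc⟩
    suffices ∃ p, ∀ β : EvalPoint K 51,
        algebraMap F K (traceEncoder F K m p β) = f.eval (β : K) by
      obtain ⟨p, hp⟩ := this
      exact ⟨p, funext fun β => FaithfulSMul.algebraMap_injective F K ((hp β).trans (hc β).symm)⟩
    clear hc
    induction hf using Submodule.span_induction with
    | zero => exact ⟨0, fun β => by simp⟩
    | add f g _ _ hf hg =>
      obtain ⟨p, hp⟩ := hf
      obtain ⟨p', hp'⟩ := hg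
      exact ⟨p + p', fun β => by simp [hp, hp']⟩
    | smul r f _ hf =>
      obtain ⟨p, hp⟩ := hf
      exact ⟨r • p, fun β => by
        rw [map_smul, Pi.smul_apply, smul_eq_mul, map_mul, hp, Polynomial.eval_smul,
          Algebra.smul_def]⟩
    | mem f hf =>
      obtain ⟨a, γ, ha, hγ, rfl⟩ := hf
      rw [cyclotomicCoset_mem_cosetFamily] at ha
      obtain ⟨_, hb, hab⟩ := ha
      obtain ⟨j, hj, rfl⟩ := Finset.mem_image.mp hb
      rw [Finset.mem_range] at hj
      rcases j with _ | j
      · obtain rfl : a = 0 := by simpa using hab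
        rw [cyclotomicCoset_zero, Set.ncard_singleton, pow_one] at hγ
        obtain ⟨t, rfl⟩ := mem_range_algebraMap_of_pow_eq hF hK hγ
        refine ⟨(t, 0), fun β => ?_⟩
        rw [eval_cosetPolynomial_zero]
        simp [traceEncoder_apply]
      · have hne := mul_sixteen_ne_self (j := j) (by omega)
        have hsingle (δ : K) (β : EvalPoint K 51) :
            algebraMap F K (traceEncoder F K m (0, Pi.single ⟨j, by omega⟩ δ) β) =
              δ * (β : K) ^ (4 * (j + 1)) + δ ^ 16 * (β : K) ^ (16 * (4 * (j + 1))) := by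
          rw [traceEncoder_apply, Finset.sum_eq_single ⟨j, by omega⟩]
          · simp only [zero_add, Pi.single_eq_same]
            rw [algebraMap_trace_of_card_eq hF hK, mul_pow, ← pow_mul, mul_comm 16]
          · intro i _ hi
            simp [hi]
          · simp
        rcases hab with rfl | rfl
        · exact ⟨_, fun β => by rw [hsingle γ, eval_cosetPolynomial hne]⟩
        -- Moving to the other representative of the coset replaces `γ` by its conjugate `γ ^ 16`.
        · refine ⟨_, fun β => (hsingle (γ ^ 16) β).trans ?_⟩
          have h : ((4 * (j + 1) : ℕ) : ZMod 51) * 16 = ((16 * (4 * (j + 1)) : ℕ) : ZMod 51) := by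
            push_cast
            ring
          have h51 : ¬ 51 ∣ 4 * (j + 1) := by omega
          rw [h, eval_cosetPolynomial, pow_of_card_eq hK, add_comm]
          · congr 2
            rw [show 16 * (16 * (4 * (j + 1))) = 4 * (j + 1) + 51 * (20 * (j + 1)) by ring,
              β.pow_add_period (by omega)]
          · rw [← h, mul_sixteen_mul_sixteen]
            exact hne.symm
  · rintro _ ⟨⟨t, γ⟩, rfl⟩
    refine ⟨cosetPolynomial K 16 51 ((0 : ℕ) : ZMod 51) (algebraMap F K t) +
      ∑ j : Fin m, cosetPolynomial K 16 51 ((4 * (j.1 + 1) : ℕ) : ZMod 51) (γ j), ?_, fun β => ?_⟩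
    · have hmem (j : ℕ) (hj : j < m + 1) :
          cyclotomicCoset 16 51 ((4 * j : ℕ) : ZMod 51) ∈ cosetFamily (cosetReps m) :=
        Set.mem_image_of_mem _ (Finset.mem_image_of_mem _ (Finset.mem_range.mpr hj))
      refine add_mem (Submodule.subset_span ⟨_, _, hmem 0 (by omega), ?_, rfl⟩)
        (sum_mem fun j _ => Submodule.subset_span ⟨_, _, hmem (j + 1) (by omega), ?_, rfl⟩)
      · simp only [mul_zero, Nat.cast_zero, cyclotomicCoset_zero, Set.ncard_singleton, pow_one]
        rw [← map_pow, pow_sixteen_of_card_eq hF]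
      · rw [cyclotomicCoset_eq_pair, Set.ncard_pair (mul_sixteen_ne_self (by omega)), pow_two,
          pow_mul, pow_of_card_eq hK]
    · rw [algebraMap_traceEncoder hF hK, Polynomial.eval_add, Nat.cast_zero,
        eval_cosetPolynomial_zero, Polynomial.eval_finsetSum]
      congr 1
      refine Finset.sum_congr rfl fun j _ => ?_
      rw [eval_cosetPolynomial (mul_sixteen_ne_self (by omega)), ← mul_assoc]
      norm_num

end TraceCode

/-! ### Dimension, self-orthogonality and dual distance. -/

section TraceCodeProperties

variable {F K : Type*} [Field F] [Field K] [Algebra F K]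

theorem two_eq_zero_of_card_eq_of_algebra (hF : Nat.card F = 16) : (2 : K) = 0 := by
  rw [← map_ofNat (algebraMap F K) 2, two_eq_zero_of_card_eq hF, map_zero]

/-- The value at `0` is `t`. Pairing with the power `51 - 4 (k + 1)` then extracts `γ k`, since only
that monomial reaches exponent `51`, where the power sum is `1`. -/
theorem traceEncoder_injective (hF : Nat.card F = 16) (hK : Nat.card K = 16 ^ 2) {m : ℕ}
    (hm : m ≤ 9) : Function.Injective (traceEncoder F K m) := by
  have : Finite K := Nat.finite_of_card_ne_zero (by simp [hK])
  have := Fintype.ofFinite (EvalPoint K 51)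
  have h2 : (2 : K) = 0 := two_eq_zero_of_card_eq_of_algebra hF
  rw [← LinearMap.ker_eq_bot, LinearMap.ker_eq_bot']
  rintro ⟨t, γ⟩ h
  have ht : t = 0 := by
    simpa [traceEncoder_apply] using congrFun h (⟨0, Or.inr rfl⟩ : EvalPoint K 51)
  subst ht
  refine Prod.ext rfl (funext fun k => ?_)
  have hexp : ∀ j < 9, ∀ k < 9, (j = k ∨ ¬ 51 ∣ 4 * (j + 1) + (51 - 4 * (k + 1))) ∧
      ¬ 51 ∣ 64 * (j + 1) + (51 - 4 * (k + 1)) := by decide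
  calc γ k = ∑ β : EvalPoint K 51, algebraMap F K (traceEncoder F K m (0, γ) β) *
        (β : K) ^ (51 - 4 * (k.1 + 1)) := ?_
    _ = 0 := by simp [h]
  simp only [algebraMap_traceEncoder hF hK, map_zero, zero_add, Finset.sum_mul, add_mul, mul_assoc,
    ← pow_add]
  rw [Finset.sum_comm, Finset.sum_eq_single k]
  · rw [Finset.sum_add_distrib, ← Finset.mul_sum, ← Finset.mul_sum,
      sum_evalPoint_pow hK (hexp k (by omega) k (by omega)).2,
      show 4 * (k.1 + 1) + (51 - 4 * (k.1 + 1)) = 51 by omega, sum_evalPoint_pow_period hK h2]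
    simp
  · intro j _ hj
    have hjk := hexp j (by omega) k (by omega)
    rw [Finset.sum_add_distrib, ← Finset.mul_sum, ← Finset.mul_sum, sum_evalPoint_pow hK hjk.2,
      sum_evalPoint_pow hK (hjk.1.resolve_left fun h => hj (Fin.ext h))]
    simp
  · simp

theorem finrank_cosetCode (hF : Nat.card F = 16) (hK : Nat.card K = 16 ^ 2) {m : ℕ}
    (hm : m ≤ 9) :
    Module.finrank F (cosetCode F K 16 51 (cosetFamily (cosetReps m))) = 1 + 2 * m := by
  have : Finite K := Nat.finite_of_card_ne_zero (by simp [hK])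
  rw [cosetCode_eq_range hF hK hm,
    LinearMap.finrank_range_of_inj (traceEncoder_injective hF hK hm), Module.finrank_prod,
    Module.finrank_self, Module.finrank_pi_fintype]
  simp [finrank_eq_two_of_card_eq hF hK, mul_comm]

/-- The exponents of the monomials that occur in the codewords, before reduction modulo `51`. -/
def codeExponents (m : ℕ) : Finset ℕ :=
  insert 0 ((Finset.range m).image (fun j => 4 * (j + 1)) ∪
    (Finset.range m).image (fun j => 64 * (j + 1)))

theorem algebraMap_traceEncoder_mem_span (hF : Nat.card F = 16) (hK : Nat.card K = 16 ^ 2) {m : ℕ}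
    (p : F × (Fin m → K)) :
    (fun β => algebraMap F K (traceEncoder F K m p β)) ∈ Submodule.span K
      ((fun b : ℕ => fun β : EvalPoint K 51 => (β : K) ^ b) '' codeExponents m) := by
  have hmem {b : ℕ} (hb : b ∈ codeExponents m) (x : K) :
      (fun β : EvalPoint K 51 => x * (β : K) ^ b) ∈ Submodule.span K
        ((fun b : ℕ => fun β : EvalPoint K 51 => (β : K) ^ b) '' codeExponents m) :=
    Submodule.smul_mem _ x (Submodule.subset_span (Set.mem_image_of_mem _ hb))
  have h : (fun β => algebraMap F K (traceEncoder F K m p β)) =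
      (fun β : EvalPoint K 51 => algebraMap F K p.1 * (β : K) ^ 0) +
        ∑ j : Fin m, ((fun β : EvalPoint K 51 => p.2 j * (β : K) ^ (4 * (j.1 + 1))) +
          fun β : EvalPoint K 51 => p.2 j ^ 16 * (β : K) ^ (64 * (j.1 + 1))) := by
    ext β
    simp [algebraMap_traceEncoder hF hK]
  rw [h]
  refine add_mem (hmem (by simp [codeExponents]) _) (sum_mem fun j _ => add_mem (hmem ?_ _)
    (hmem ?_ _))
  · exact Finset.mem_insert_of_mem (Finset.mem_union_left _
      (Finset.mem_image_of_mem (fun j => 4 * (j + 1)) (Finset.mem_range.mpr j.2)))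
  · exact Finset.mem_insert_of_mem (Finset.mem_union_right _
      (Finset.mem_image_of_mem (fun j => 64 * (j + 1)) (Finset.mem_range.mpr j.2)))

/-- The code is self-orthogonal for the Hermitian form. -/
theorem sum_mul_pow_four_eq_zero [Fintype (EvalPoint K 51)] (hF : Nat.card F = 16)
    (hK : Nat.card K = 16 ^ 2) {m : ℕ} (hm : m ≤ 9) {c c' : EvalPoint K 51 → F}
    (hc : c ∈ LinearMap.range (traceEncoder F K m))
    (hc' : c' ∈ LinearMap.range (traceEncoder F K m)) : ∑ β, c β * c' β ^ 4 = 0 := by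
  have h2 : (2 : K) = 0 := two_eq_zero_of_card_eq_of_algebra hF
  have : CharP K 2 := CharTwo.of_one_ne_zero_of_two_eq_zero one_ne_zero h2
  have hadd (x y : K) : (x + y) ^ 4 = x ^ 4 + y ^ 4 := by
    simpa using add_pow_char_pow (p := 2) (n := 2) (x := x) (y := y)
  have hexp : ∀ i ∈ codeExponents m, ∀ j ∈ codeExponents m,
      ∑ β : EvalPoint K 51, (β : K) ^ (i + j * 4) = 0 := by
    have h9 : ∀ i ∈ codeExponents 9, ∀ j ∈ codeExponents 9, i + j * 4 = 0 ∨ ¬ 51 ∣ i + j * 4 := by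
      decide
    have hsub : codeExponents m ⊆ codeExponents 9 := by
      have hr := Finset.range_mono hm
      exact Finset.insert_subset_insert _
        (Finset.union_subset_union (Finset.image_subset_image hr) (Finset.image_subset_image hr))
    intro i hi j hj
    rcases h9 i (hsub hi) j (hsub hj) with h | h
    · rw [h, sum_evalPoint_pow_zero hK h2]
    · exact sum_evalPoint_pow hK h
  have hspan (u v : EvalPoint K 51 → K)
      (hu : u ∈ Submodule.span K
        ((fun b : ℕ => fun β : EvalPoint K 51 => (β : K) ^ b) '' codeExponents m))
      (hv : v ∈ Submodule.span K
        ((fun b : ℕ => fun β : EvalPoint K 51 => (β : K) ^ b) '' codeExponents m)) :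
      ∑ β, u β * v β ^ 4 = 0 := by
    induction hv using Submodule.span_induction with
    | zero => simp
    | add v v' _ _ hv hv' =>
      simp only [Pi.add_apply, hadd, mul_add, Finset.sum_add_distrib, hv, hv', add_zero]
    | smul r v _ hv =>
      simp only [Pi.smul_apply, smul_eq_mul, mul_pow, mul_left_comm (u _), ← Finset.mul_sum, hv,
        mul_zero]
    | mem v hv =>
      obtain ⟨j, hj, rfl⟩ := hv
      induction hu using Submodule.span_induction with
      | zero => simp
      | add u u' _ _ hu hu' =>
        simp only [Pi.add_apply, add_mul, Finset.sum_add_distrib, hu, hu', add_zero]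
      | smul r u _ hu =>
        simp only [Pi.smul_apply, smul_eq_mul, mul_assoc, ← Finset.mul_sum, hu, mul_zero]
      | mem u hu =>
        obtain ⟨i, hi, rfl⟩ := hu
        simp only [← pow_mul, ← pow_add]
        exact hexp i hi j hj
  obtain ⟨p, rfl⟩ := hc
  obtain ⟨p', rfl⟩ := hc'
  apply FaithfulSMul.algebraMap_injective F K
  rw [map_zero, map_sum]
  simp only [map_mul, map_pow]
  exact hspan _ _ (algebraMap_traceEncoder_mem_span hF hK p)
    (algebraMap_traceEncoder_mem_span hF hK p')

/-- The codewords take all values on any fewer than `d` evaluation points. -/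
theorem exists_mem_range_traceEncoder_eq (hF : Nat.card F = 16) (hK : Nat.card K = 16 ^ 2)
    {m d : ℕ} (hd : ∀ i, i + 2 ≤ d → i ≤ m ∨ i = 10 ∧ 7 ≤ m) (J : Set (EvalPoint K 51))
    (hJ : J.ncard < d) (w : EvalPoint K 51 → F) :
    ∃ c ∈ LinearMap.range (traceEncoder F K m), ∀ β ∈ J, c β = w β := by
  classical
  have : Finite K := Nat.finite_of_card_ne_zero (by simp [hK])
  have : Finite F := Nat.finite_of_card_ne_zero (by simp [hF])
  have := Fintype.ofFinite J
  have h2 : (2 : K) = 0 := two_eq_zero_of_card_eq_of_algebra hF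
  have : CharP K 2 := CharTwo.of_one_ne_zero_of_two_eq_zero one_ne_zero h2
  suffices (LinearMap.range (traceEncoder F K m)).map
      (LinearMap.funLeft F F (Subtype.val : J → EvalPoint K 51)) = ⊤ by
    obtain ⟨c, hc, h⟩ := this.ge (Submodule.mem_top (x := fun β : J => w β))
    exact ⟨c, hc, fun β hβ => congrFun h ⟨β, hβ⟩⟩
  by_contra hne
  -- If the restriction to `J` is not onto, a nonzero functional, with weights `y`, kills it.
  obtain ⟨f, hf0, hf⟩ := Submodule.exists_le_ker_of_lt_top _ (lt_top_iff_ne_top.mpr hne)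
  let y : J → F := fun β => f fun β' => if β = β' then 1 else 0
  have hfy (w : J → F) : f w = ∑ β, w β * y β := f.pi_apply_eq_sum_univ w
  have horth (p : F × (Fin m → K)) : ∑ β : J, traceEncoder F K m p β * y β = 0 := by
    rw [← hfy fun β : J => traceEncoder F K m p β]
    exact hf (Submodule.mem_map_of_mem (LinearMap.mem_range_self _ p))
  have hzero : ∑ β : J, algebraMap F K (y β) = 0 := by
    have h := horth (1, 0)
    rw [← map_sum]
    simpa [traceEncoder_apply] using congrArg (algebraMap F K) h
  -- Orthogonality holds for every `γ`, so nondegeneracy of the trace form removes the trace.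
  have hpow (j : Fin m) : ∑ β : J, algebraMap F K (y β) * (β : K) ^ (4 * (j.1 + 1)) = 0 := by
    refine (traceForm_nondegenerate F K).1 _ fun γ => ?_
    rw [Algebra.traceForm_apply, ← horth (0, Pi.single j γ), Finset.sum_mul, map_sum]
    refine Finset.sum_congr rfl fun β _ => ?_
    rw [traceEncoder_apply, Finset.sum_eq_single j]
    · rw [mul_assoc, ← Algebra.smul_def, map_smul, smul_eq_mul, mul_comm (y β)]
      simp [mul_comm]
    · intro i _ hi
      simp [hi]
    · simp
  have hall (i : ℕ) (hi : i + 2 ≤ d) :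
      ∑ β : J, algebraMap F K (y β) * ((β : K) ^ 4) ^ i = 0 := by
    simp only [← pow_mul]
    rcases hd i hi with hi | ⟨rfl, hm⟩
    · rcases i with _ | i
      · simpa using hzero
      · exact hpow ⟨i, hi⟩
    -- The sixteenth power fixes `y` and sends exponent `28` to `448 = 40 + 51 * 8`.
    · have h := congrArg (iterateFrobenius K 2 4) (hpow ⟨6, hm⟩)
      rw [map_sum, map_zero] at h
      refine (Finset.sum_congr rfl fun β _ => ?_).trans h
      rw [iterateFrobenius_def, mul_pow, ← map_pow]
      norm_num only
      rw [pow_sixteen_of_card_eq hF, ← pow_mul, ← β.1.pow_add_period (a := 40) (by norm_num) 8]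
  let e := Fintype.equivFin J
  have hcard : Fintype.card J < d := by
    rwa [← Nat.card_eq_fintype_card, Nat.card_coe_set_eq]
  -- Vandermonde: the nodes `β ^ 4` are distinct because the fourth power is injective in
  -- characteristic `2`, and `J` has at most `d - 1` points.
  have hy := Matrix.eq_zero_of_forall_pow_sum_mul_pow_eq_zero
    (f := fun i => ((e.symm i : EvalPoint K 51) : K) ^ 4)
    (v := fun i => algebraMap F K (y (e.symm i)))
    (fun i j hij => by
      have h := iterateFrobenius_inj K 2 2 (a₁ := ((e.symm i : EvalPoint K 51) : K))
        (a₂ := ((e.symm j : EvalPoint K 51) : K)) (by simpa [iterateFrobenius_def] using hij)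
      exact e.symm.injective (Subtype.ext (Subtype.ext h)))
    (fun i => (e.symm.sum_comp fun β : J => algebraMap F K (y β) * ((β : K) ^ 4) ^ i.1).trans
      (hall i (by omega)))
  refine hf0 (LinearMap.ext fun w => ?_)
  rw [hfy]
  refine Finset.sum_eq_zero fun β _ => ?_
  have h : y β = 0 := by
    apply FaithfulSMul.algebraMap_injective F K
    simpa using congrFun hy (e β)
  rw [h, mul_zero]

theorem exists_isQuantumCode_cosetCode (hF : Nat.card F = 16) (hK : Nat.card K = 16 ^ 2)
    {m k d : ℕ} (hm : m ≤ 9) (hd : ∀ i, i + 2 ≤ d → i ≤ m ∨ i = 10 ∧ 7 ≤ m)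
    (hk : k + 2 * Module.finrank F (cosetCode F K 16 51 (cosetFamily (cosetReps m))) = 52) :
    ∃ Q, IsQuantumCode 4 52 k d Q := by
  have : Finite K := Nat.finite_of_card_ne_zero (by simp [hK])
  have := Fintype.ofFinite (EvalPoint K 51)
  let e : Fin 52 ≃ EvalPoint K 51 :=
    (Fintype.equivFinOfCardEq (by rw [← Nat.card_eq_fintype_card, card_evalPoint hK])).symm
  rw [cosetCode_eq_range hF hK hm] at hk
  refine exists_isQuantumCode_of_hermitian hF
    ((LinearMap.range (traceEncoder F K m)).map
      (LinearEquiv.funCongrLeft F F e).toLinearMap) ?_ ?_ ?_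
  · rintro _ ⟨c, hc, rfl⟩ _ ⟨c', hc', rfl⟩
    rw [← sum_mul_pow_four_eq_zero hF hK hm hc hc', ← e.sum_comp]
    rfl
  · rw [LinearEquiv.finrank_map_eq]
    exact hk
  · intro J hJ w
    obtain ⟨c, hc, h⟩ := exists_mem_range_traceEncoder_eq hF hK hd (e '' J)
      (by rwa [Set.ncard_image_of_injective _ e.injective]) fun β => w (e.symm β)
    refine ⟨_, Submodule.mem_map_of_mem hc, fun i hi => ?_⟩
    simpa using h (e i) (Set.mem_image_of_mem _ hi)

end TraceCodeProperties

/-! ### The parameters of the theorem. -/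

theorem mainTheorem5 (F K : Type*) [Field F] [Field K] [Algebra F K]
    (hF : Nat.card F = 16) (hK : Nat.card K = 16 ^ 2) :
    orderOf (16 : ZMod 51) = 2 ∧
    (∀ 𝒮 : Set (Set (ZMod 51)), 𝒮 = {{0}, {12, 39}, {8, 26}, {4, 13}} →
      scaledFamily 16 51 4 𝒮 = {{0}, {1, 16}, {2, 32}, {3, 48}} ∧
      dualFamily 16 51 (scaledFamily 16 51 4 𝒮) = {{0}, {3, 48}, {19, 49}, {35, 50}} ∧
      IsAdmissible 16 51 4 5 𝒮 ∧
      38 + 2 * Module.finrank F (cosetCode F K 16 51 𝒮) = 52 ∧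
      ∃ Q, IsQuantumCode 4 52 38 5 Q) ∧
    ∀ k d : ℕ,
      (k, d) ∈ ({(34, 6), (30, 7), (26, 8), (22, 9), (18, 10), (14, 12)} : Set (ℕ × ℕ)) →
      ∃ 𝒮 : Set (Set (ZMod 51)), IsAdmissible 16 51 4 d 𝒮 ∧
        k + 2 * Module.finrank F (cosetCode F K 16 51 𝒮) = 52 ∧
        ∃ Q, IsQuantumCode 4 52 k d Q := by
  -- The bound `m ≤ 9` keeps the cosets distinct: `40 ≡ 28 * 16` modulo `51`, so `m = 10` would
  -- repeat one.
  have main {m k d : ℕ} (hm : m ≤ 9) (hk : k + 4 * m = 50)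
      (hd : ∀ i, i + 2 ≤ d → i ≤ m ∨ i = 10 ∧ 7 ≤ m)
      (h : ∀ a < 51, 53 ≤ a + d → ∃ j ≤ m, (a : ZMod 51) = -((4 * j : ℕ) * 4) ∨
        (a : ZMod 51) = -((4 * j : ℕ) * 4) * 16) :
      IsAdmissible 16 51 4 d (cosetFamily (cosetReps m)) ∧
        k + 2 * Module.finrank F (cosetCode F K 16 51 (cosetFamily (cosetReps m))) = 52 ∧
        ∃ Q, IsQuantumCode 4 52 k d Q := by
    have hdim :
        k + 2 * Module.finrank F (cosetCode F K 16 51 (cosetFamily (cosetReps m))) = 52 := by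
      rw [finrank_cosetCode hF hK hm]
      omega
    exact ⟨isAdmissible_cosetFamily hm h, hdim, exists_isQuantumCode_cosetCode hF hK hm hd hdim⟩
  refine ⟨orderOf_sixteen, ?_, ?_⟩
  · rintro _ rfl
    rw [← cosetFamily_cosetReps_three]
    exact ⟨scaledFamily_cosetReps_three, dualFamily_cosetReps_three,
      main (by norm_num) (by norm_num) (by omega) (by decide)⟩
  · intro k d hkd
    simp only [Set.mem_insert_iff, Set.mem_singleton_iff, Prod.mk.injEq] at hkd
    rcases hkd with ⟨rfl, rfl⟩ | ⟨rfl, rfl⟩ | ⟨rfl, rfl⟩ | ⟨rfl, rfl⟩ | ⟨rfl, rfl⟩ | ⟨rfl, rfl⟩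
    · exact ⟨_, main (m := 4) (by norm_num) (by norm_num) (by omega) (by decide)⟩
    · exact ⟨_, main (m := 5) (by norm_num) (by norm_num) (by omega) (by decide)⟩
    · exact ⟨_, main (m := 6) (by norm_num) (by norm_num) (by omega) (by decide)⟩
    · exact ⟨_, main (m := 7) (by norm_num) (by norm_num) (by omega) (by decide)⟩
    · exact ⟨_, main (m := 8) (by norm_num) (by norm_num) (by omega) (by decide)⟩
    · exact ⟨_, main (m := 9) (by norm_num) (by norm_num) (by omega) (by decide)⟩
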